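/- All graphs are finite, simple and connected. For a graph $H$, let $\delta(H)$ be its minimum degree, $\rho(H)$ the largest eigenvalue of its adjacency matrix, $i(H)$ the number of its isolated vertices, and $\mathrm{odd}(H)$ the number of its connected components that have an odd number of vertices, at least three. For an odd integer $k\ge 3$, a graph $G$ of odd order is called generalized factor-critical ($\mathrm{GFC}_k$) if $S=\varnothing$ is the only subset $S\subseteq V(G)$ at which $$\mathrm{odd}(G-S)+k\cdot i(G-S)-k|S|$$ attains its maximum over all subsets of $V(G)$. Let $+$ denote disjoint union of graphs, $\vee$ the join (disjoint union together with all edges between the two graphs), $K_m$ the complete graph on $m$ vertices, and $\overline{K_m}$ the graph with $m$ vertices and no edges. Let $\delta$ be a positive integer, let $k\geq 3$ be an odd integer, and let $G$ be a connected graph of odd order $n\geq 8\delta+4$ with minimum degree $\delta(G)\geq\delta$. If $\rho(G)\geq \rho\bigl(K_\delta\vee(K_{n-2\delta}+\overline{K_\delta})\bigr)$, then $G$ is $\mathrm{GFC}_k$ unless $G= K_\delta\vee(K_{n-2\delta}+\overline{K_\delta})$ (up to isomorphism). -/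

import Mathlib

namespace KMatching

/-- The join `G ∨ H`: the disjoint union of `G` and `H` together with all edges between the two
vertex sets. -/
def join {V W : Type*} (G : SimpleGraph V) (H : SimpleGraph W) : SimpleGraph (V ⊕ W) :=
  SimpleGraph.sum G H ⊔ completeBipartiteGraph V W

/-- The graph `K_δ ∨ (K_{n-2δ} + K̄_δ)`; it has order `n` as soon as `2 * δ ≤ n`. -/
abbrev extremalGraph (n δ : ℕ) : SimpleGraph (Fin δ ⊕ (Fin (n - 2 * δ) ⊕ Fin δ)) :=
  join (⊤ : SimpleGraph (Fin δ))
    (SimpleGraph.sum (⊤ : SimpleGraph (Fin (n - 2 * δ))) (⊥ : SimpleGraph (Fin δ)))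

open Classical in
/-- The adjacency spectral radius `ρ(G)`: the largest eigenvalue of the adjacency matrix. -/
noncomputable def rho {V : Type*} [Fintype V] (G : SimpleGraph V) : ℝ :=
  sSup {t : ℝ | Module.End.HasEigenvalue (Matrix.toLin' (G.adjMatrix ℝ)) t}

open Classical in
/-- On a nonempty vertex set, `rho G` is an eigenvalue of the adjacency matrix, and it is the
largest one. -/
theorem isGreatest_rho {V : Type*} [Fintype V] [Nonempty V] (G : SimpleGraph V) :
    IsGreatest {t : ℝ | Module.End.HasEigenvalue (Matrix.toLin' (G.adjMatrix ℝ)) t} (rho G) := by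
  have h : {t : ℝ | Module.End.HasEigenvalue (Matrix.toLin' (G.adjMatrix ℝ)) t} =
      Set.range (G.isHermitian_adjMatrix ℝ).eigenvalues := by
    rw [← Matrix.IsHermitian.spectrum_real_eq_range_eigenvalues]
    ext t
    rw [Set.mem_ofPred_eq, Module.End.hasEigenvalue_iff_mem_spectrum, Matrix.spectrum_toLin']
  have hfin : {t : ℝ | Module.End.HasEigenvalue (Matrix.toLin' (G.adjMatrix ℝ)) t}.Finite := by
    rw [h]; exact Set.finite_range _
  have hne : {t : ℝ | Module.End.HasEigenvalue (Matrix.toLin' (G.adjMatrix ℝ)) t}.Nonempty := by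
    rw [h]; exact Set.range_nonempty _
  exact ⟨hne.csSup_mem hfin, fun t ht => le_csSup hfin.bddAbove ht⟩

/-- `i(H)`: the number of isolated vertices of `H`. -/
noncomputable def isolatedCount {V : Type*} (H : SimpleGraph V) : ℕ :=
  {v : V | H.IsIsolated v}.ncard

/-- `odd(H)`: the number of nontrivial odd components of `H`, that is, of the connected components
with an odd number of vertices other than the isolated vertices. -/
noncomputable def nontrivialOddCount {V : Type*} (H : SimpleGraph V) : ℕ :=
  {c : H.ConnectedComponent | Odd c.supp.ncard ∧ 1 < c.supp.ncard}.ncard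

/-- `G - S`. -/
abbrev deleteVerts {V : Type*} (G : SimpleGraph V) (S : Set V) : SimpleGraph (Sᶜ : Set V) :=
  G.induce Sᶜ

/-- The quantity that is maximized over `S ⊆ V(G)` in the `k`-Berge-Tutte formula. -/
noncomputable def bergeTutteValue {V : Type*} (k : ℕ) (G : SimpleGraph V) (S : Set V) : ℤ :=
  if Even k then
    (k : ℤ) * isolatedCount (deleteVerts G S) - k * S.ncard
  else
    (nontrivialOddCount (deleteVerts G S) : ℤ) + k * isolatedCount (deleteVerts G S) - k * S.ncard

/-- `S` is a `k`-barrier of `G`: it attains the maximum in the `k`-Berge-Tutte formula. -/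
def IsBarrier {V : Type*} (k : ℕ) (G : SimpleGraph V) (S : Set V) : Prop :=
  ∀ T : Set V, bergeTutteValue k G T ≤ bergeTutteValue k G S

/-- `G` is generalized factor-critical (`GFC_k`): it has odd order and the empty set is its only
`k`-barrier. -/
def IsGFC {V : Type*} [Fintype V] (k : ℕ) (G : SimpleGraph V) : Prop :=
  Odd (Fintype.card V) ∧ ∀ S : Set V, IsBarrier k G S ↔ S = ∅

end KMatching

/-! Since `G` is itself a nontrivial odd component, the value at `∅` is positive, so it suffices
that no nonempty `S` has positive value. Suppose `S` does, and write s = |S|, i for the number of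
isolated vertices of G - S, o for its number of nontrivial odd components, and x for the spectral
radius of the extremal graph. The claim is that ρ(G) < x or `G` is extremal.

By a Collatz–Wielandt argument (`rho_lt_of_nbrSum_le`) it is enough to exhibit a positive test
vector; vectors constant on `S`, on a set of isolated vertices and on the rest suffice
(`rho_lt_of_three_classes`). If s < δ, nothing is isolated and o > 3s makes degrees outside `S`
small. If s ≥ δ, the inequality left to check at `S` is governed by the sign at x + 1 of the
polynomial of K_s ∨ (K_{n-2s} + s isolated vertices): it vanishes for s = δ (`rho_extremalGraph`)
and is positive for s > δ (`quotientCharpoly_pos`). When i < s, the more than 3(s - i) odd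
components give strict slack even at s = δ. When i ≥ s = δ, `G` spans a subgraph of the extremal
graph, and Perron monotonicity (`nonempty_iso_of_rho_le`) finishes. -/

namespace KMatching

open Finset

/-! ### Perron–Frobenius for adjacency matrices -/

open Classical in
/-- The image of `v` under the adjacency operator, at the vertex `u`. -/
noncomputable def nbrSum {V : Type*} [Fintype V] (G : SimpleGraph V) (v : V → ℝ) (u : V) : ℝ :=
  ∑ w, if G.Adj u w then v w else 0

open Classical in
theorem adjMatrix_mulVec_eq_nbrSum {V : Type*} [Fintype V] (G : SimpleGraph V) (v : V → ℝ) :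
    (G.adjMatrix ℝ).mulVec v = nbrSum G v := by
  funext u
  simp [nbrSum, Matrix.mulVec, dotProduct, SimpleGraph.adjMatrix_apply]

theorem sum_mul_nbrSum_comm {V : Type*} [Fintype V] (G : SimpleGraph V) (y v : V → ℝ) :
    ∑ u, y u * nbrSum G v u = ∑ u, nbrSum G y u * v u := by
  classical
  simp only [nbrSum, Finset.mul_sum, Finset.sum_mul]
  rw [Finset.sum_comm]
  refine Finset.sum_congr rfl fun u _ => Finset.sum_congr rfl fun w _ => ?_
  simp only [G.adj_comm u w]
  split_ifs <;> simp

open Classical in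
theorem posSemidef_rho_sub_adjMatrix {V : Type*} [Fintype V] [Nonempty V] (G : SimpleGraph V) :
    (rho G • (1 : Matrix V V ℝ) - G.adjMatrix ℝ).PosSemidef := by
  have hH : (rho G • (1 : Matrix V V ℝ) - G.adjMatrix ℝ).IsHermitian := by
    refine Matrix.IsHermitian.sub ?_ (G.isHermitian_adjMatrix ℝ)
    simp [Matrix.IsHermitian]
  refine hH.posSemidef_iff_eigenvalues_nonneg.mpr fun j => ?_
  have hj : Module.End.HasEigenvalue
      (Matrix.toLin' (rho G • (1 : Matrix V V ℝ) - G.adjMatrix ℝ)) (hH.eigenvalues j) := by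
    rw [Module.End.hasEigenvalue_iff_mem_spectrum, Matrix.spectrum_toLin',
      hH.spectrum_real_eq_range_eigenvalues]
    exact ⟨j, rfl⟩
  obtain ⟨w, hw⟩ := hj.exists_hasEigenvector
  have hw1 := hw.apply_eq_smul
  have h2 : Module.End.HasEigenvalue (Matrix.toLin' (G.adjMatrix ℝ))
      (rho G - hH.eigenvalues j) := by
    refine Module.End.hasEigenvalue_of_hasEigenvector (x := w) ⟨?_, hw.2⟩
    rw [Module.End.mem_eigenspace_iff]
    simp only [Matrix.toLin'_apply, Matrix.sub_mulVec, Matrix.smul_mulVec,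
      Matrix.one_mulVec] at hw1 ⊢
    rw [sub_smul, ← hw1]
    abel
  have := (isGreatest_rho G).2 h2
  simp only [Pi.zero_apply]
  linarith

/-- Taking absolute values of an eigenvector for the largest eigenvalue does not lower its quadratic
form, so the result is again an eigenvector; a zero entry would spread along edges to the whole
graph. -/
theorem exists_pos_eigenvector {V : Type*} [Fintype V] {G : SimpleGraph V} (hG : G.Connected) :
    ∃ y : V → ℝ, (∀ u, 0 < y u) ∧ ∀ u, nbrSum G y u = rho G * y u := by
  classical
  have := hG.nonempty
  obtain ⟨z, hz⟩ := (isGreatest_rho G).1.exists_hasEigenvector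
  have hz1 : nbrSum G z = rho G • z := by
    rw [← adjMatrix_mulVec_eq_nbrSum]
    simpa [Matrix.toLin'_apply] using hz.apply_eq_smul
  let y : V → ℝ := fun u => |z u|
  have hP := posSemidef_rho_sub_adjMatrix G
  have hform : ∀ v : V → ℝ, v ⬝ᵥ ((rho G • (1 : Matrix V V ℝ) - G.adjMatrix ℝ).mulVec v) =
      ∑ u, v u * (rho G * v u) - ∑ u, v u * nbrSum G v u := by
    intro v
    rw [Matrix.sub_mulVec, Matrix.smul_mulVec, Matrix.one_mulVec, dotProduct_sub,
      adjMatrix_mulVec_eq_nbrSum]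
    rfl
  have hle : ∑ u, z u * nbrSum G z u ≤ ∑ u, y u * nbrSum G y u := by
    refine Finset.sum_le_sum fun u _ => ?_
    simp only [nbrSum, Finset.mul_sum]
    refine Finset.sum_le_sum fun w _ => ?_
    split_ifs
    · exact (le_abs_self _).trans (abs_mul _ _).le
    · simp
  have hsq : ∑ u, y u * (rho G * y u) = ∑ u, z u * nbrSum G z u := by
    refine Finset.sum_congr rfl fun u _ => ?_
    rw [hz1]
    simp only [Pi.smul_apply, smul_eq_mul, y]
    have := abs_mul_abs_self (z u)
    linear_combination (rho G) * this
  -- A vector on which a positive semidefinite form vanishes lies in the kernel of its matrix.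
  have h0 : star y ⬝ᵥ ((rho G • (1 : Matrix V V ℝ) - G.adjMatrix ℝ).mulVec y) = 0 := by
    refine le_antisymm ?_ (hP.dotProduct_mulVec_nonneg y)
    rw [star_trivial, hform]
    linarith
  have hy : ∀ u, nbrSum G y u = rho G * y u := by
    have h1 := (hP.dotProduct_mulVec_zero_iff y).1 h0
    intro u
    have h2 := congrFun h1 u
    rw [Matrix.sub_mulVec, Matrix.smul_mulVec, Matrix.one_mulVec,
      adjMatrix_mulVec_eq_nbrSum] at h2
    simp only [Pi.sub_apply, Pi.smul_apply, smul_eq_mul, Pi.zero_apply] at h2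
    linarith
  have hstep : ∀ u w, G.Adj u w → y u = 0 → y w = 0 := by
    intro u w huw hu
    have h1 := hy u
    rw [hu, mul_zero, nbrSum, Finset.sum_eq_zero_iff_of_nonneg
      (fun w _ => by split_ifs <;> simp [y])] at h1
    simpa [huw] using h1 w (Finset.mem_univ w)
  have hreach : ∀ u w, G.Walk u w → y u = 0 → y w = 0 := by
    intro u w p
    induction p with
    | nil => exact id
    | cons h _ ih => exact fun hu => ih (hstep _ _ h hu)
  refine ⟨y, fun u => ?_, hy⟩
  refine lt_of_le_of_ne (abs_nonneg _) fun hu => hz.2 ?_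
  funext w
  obtain ⟨p⟩ := hG.preconnected u w
  exact abs_eq_zero.1 (hreach u w p hu.symm)

/-! ### Spectral bounds from test vectors -/

/-- A positive vector that the adjacency operator of a connected graph maps below its `x`-fold, and
strictly so at some vertex, witnesses that the spectral radius is less than `x`. -/
theorem rho_lt_of_nbrSum_le {V : Type*} [Fintype V] {G : SimpleGraph V} (hG : G.Connected)
    {v : V → ℝ} {x : ℝ} (hv : ∀ u, 0 < v u) (hle : ∀ u, nbrSum G v u ≤ x * v u)
    (hlt : ∃ u, nbrSum G v u < x * v u) : rho G < x := by
  obtain ⟨y, hy, hyG⟩ := exists_pos_eigenvector hG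
  have := hG.nonempty
  have h1 : ∑ u, y u * nbrSum G v u < ∑ u, y u * (x * v u) := by
    obtain ⟨u, hu⟩ := hlt
    exact Finset.sum_lt_sum (fun u _ => mul_le_mul_of_nonneg_left (hle u) (hy u).le)
      ⟨u, Finset.mem_univ u, mul_lt_mul_of_pos_left hu (hy u)⟩
  rw [sum_mul_nbrSum_comm] at h1
  have h2 : 0 < ∑ u, y u * v u :=
    Finset.sum_pos (fun u _ => mul_pos (hy u) (hv u)) Finset.univ_nonempty
  have h3 : rho G * ∑ u, y u * v u < x * ∑ u, y u * v u := by
    simp only [hyG] at h1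
    rw [Finset.mul_sum, Finset.mul_sum]
    calc _ = ∑ u, rho G * y u * v u := Finset.sum_congr rfl fun u _ => by ring
      _ < ∑ u, y u * (x * v u) := h1
      _ = _ := Finset.sum_congr rfl fun u _ => by ring
  exact lt_of_mul_lt_mul_right h3 h2.le

/-- A connected graph that embeds as a spanning subgraph into a connected graph of no larger
spectral radius is isomorphic to it. -/
theorem nonempty_iso_of_rho_le {V W : Type*} [Fintype V] [Fintype W] {G : SimpleGraph V}
    {H : SimpleGraph W} (hG : G.Connected) (hH : H.Connected) (e : V ≃ W)
    (he : ∀ u w, G.Adj u w → H.Adj (e u) (e w)) (hrho : rho H ≤ rho G) : Nonempty (G ≃g H) := by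
  classical
  obtain ⟨y, hy, hyH⟩ := exists_pos_eigenvector hH
  by_contra hne
  have hex : ∃ u w, H.Adj (e u) (e w) ∧ ¬ G.Adj u w := by
    by_contra! h
    exact hne ⟨⟨e, fun {u w} => ⟨h u w, he u w⟩⟩⟩
  have hsum : ∀ u, nbrSum H y (e u) = ∑ w, if H.Adj (e u) (e w) then y (e w) else 0 := by
    intro u
    rw [nbrSum, ← e.sum_comp]
  have hterm : ∀ u w, (if G.Adj u w then y (e w) else 0) ≤
      if H.Adj (e u) (e w) then y (e w) else 0 := by
    intro u w
    have := (hy (e w)).le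
    by_cases h : G.Adj u w
    · simp [h, he u w h]
    · rw [if_neg h]; split_ifs <;> simp [this]
  -- The Perron vector of `H`, pulled back to `G`, is the test vector; a missing edge makes the
  -- inequality strict at its endpoint.
  refine (rho_lt_of_nbrSum_le hG (v := y ∘ e) (x := rho H) (fun u => hy _) (fun u => ?_) ?_).not_ge
    hrho
  · rw [Function.comp_apply, ← hyH, hsum]
    exact Finset.sum_le_sum fun w _ => hterm u w
  · obtain ⟨u, w, h1, h2⟩ := hex
    refine ⟨u, ?_⟩
    rw [Function.comp_apply, ← hyH, hsum]
    refine Finset.sum_lt_sum (fun w _ => hterm u w) ⟨w, Finset.mem_univ w, ?_⟩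
    simp [h1, h2, hy]

open Classical in
/-- The spectral radius bound given by a vector that is `1` on `S`, `c` on `I` and `b` elsewhere. -/
theorem rho_lt_of_three_classes {V : Type*} [Fintype V] {G : SimpleGraph V} (hG : G.Connected)
    {S I : Finset V} (hS : S.Nonempty) (hSI : Disjoint S I)
    (hI : ∀ u ∈ I, ∀ w, G.Adj u w → w ∈ S) {b c d x : ℝ} (hb : 0 < b) (hc : 0 < c)
    (hd : ∀ u, u ∉ S → u ∉ I → ((#{w | G.Adj u w ∧ w ∉ S} : ℕ) : ℝ) ≤ d)
    (h1 : #S - 1 + #I * c + (Fintype.card V - #S - #I) * b < x) (h2 : #S ≤ x * c)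
    (h3 : #S + d * b ≤ x * b) : rho G < x := by
  let v : V → ℝ := fun u => if u ∈ S then 1 else if u ∈ I then c else b
  have hv : ∀ u, 0 < v u := fun u => by simp only [v]; split_ifs <;> simp [hb, hc]
  have hvI : ∀ u ∈ I, v u = c := fun u hu => by
    simp [v, hu, Finset.disjoint_right.1 hSI hu]
  have hsumS : ∑ w ∈ S, v w = #S := by
    rw [Finset.sum_congr rfl (g := fun _ => (1 : ℝ)) (fun u hu => by simp [v, hu])]
    simp
  have htot : ∑ w, v w = #S + #I * c + (Fintype.card V - #S - #I) * b := by
    have hU : #(S ∪ I)ᶜ = (Fintype.card V - #S - #I : ℝ) := by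
      rw [Finset.card_compl, Nat.cast_sub (Finset.card_le_univ _),
        Finset.card_union_of_disjoint hSI]
      push_cast; ring
    rw [← Finset.sum_add_sum_compl (S ∪ I), Finset.sum_union hSI, hsumS,
      Finset.sum_congr rfl hvI,
      Finset.sum_congr rfl (g := fun _ => b) (s₁ := (S ∪ I)ᶜ) (fun u hu => by
        simp only [Finset.mem_compl, Finset.mem_union, not_or] at hu
        simp [v, hu.1, hu.2])]
    rw [Finset.sum_const, Finset.sum_const, nsmul_eq_mul, nsmul_eq_mul, hU]
  have hSlt : ∀ u ∈ S, nbrSum G v u < x * v u := by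
    intro u hu
    -- At a vertex of `S` the worst case is adjacency to everything else.
    have h5 : v u + nbrSum G v u ≤ ∑ w, v w := by
      rw [← Finset.add_sum_erase _ v (Finset.mem_univ u), nbrSum,
        ← Finset.add_sum_erase _ _ (Finset.mem_univ u), if_neg (G.loopless.irrefl u), zero_add]
      gcongr with w
      split_ifs
      · exact le_rfl
      · exact (hv w).le
    have h6 : v u = 1 := by simp [v, hu]
    rw [htot, h6] at h5
    rw [h6]
    linarith
  refine rho_lt_of_nbrSum_le hG hv (fun u => ?_) (hS.imp fun u hu => hSlt u hu)
  by_cases huS : u ∈ S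
  · exact (hSlt u huS).le
  have hsplit : nbrSum G v u ≤ #S + ∑ w ∈ {w | G.Adj u w ∧ w ∉ S}, v w := by
    rw [nbrSum, ← hsumS, ← Finset.sum_filter, ← Finset.sum_filter_add_sum_filter_not _ (· ∈ S),
      Finset.filter_filter, Finset.filter_filter]
    refine add_le_add (Finset.sum_le_sum_of_subset_of_nonneg ?_ fun w _ _ => (hv w).le) le_rfl
    exact fun w hw => (Finset.mem_filter.1 hw).2.2
  by_cases huI : u ∈ I
  · rw [hvI u huI]
    rw [Finset.filter_false_of_mem (fun w _ h => h.2 (hI u huI w h.1)), Finset.sum_empty] at hsplit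
    linarith
  · have h7 : v u = b := by simp [v, huS, huI]
    have h8 : ∑ w ∈ {w | G.Adj u w ∧ w ∉ S}, v w = #{w | G.Adj u w ∧ w ∉ S} * b := by
      rw [Finset.sum_congr rfl (g := fun _ => b)]
      · simp
      · intro w hw
        obtain ⟨ha, hwS⟩ := (Finset.mem_filter.1 hw).2
        have hwI : w ∉ I := fun h => huS (hI w h u ha.symm)
        simp [v, hwS, hwI]
    rw [h8] at hsplit
    rw [h7]
    nlinarith [hd u huS huI]

/-! ### The quotient polynomial -/

/-- The characteristic polynomial of the quotient matrix of `K_s ∨ (K_{n-2s} + K̄_s)`, evaluated at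
`X - 1`. -/
def quotientCharpoly (n s X : ℝ) : ℝ :=
  (X - s) * (X - n + 2 * s) * (X - 1) - s * (n - 2 * s) * (X - 1) - s ^ 2 * (X - n + 2 * s)

theorem extremalGraph_connected {n δ : ℕ} (hδ : 0 < δ) : (extremalGraph n δ).Connected := by
  have h : ∀ u, (extremalGraph n δ).Reachable (Sum.inl ⟨0, hδ⟩) u := by
    intro u
    by_cases hu : u = Sum.inl ⟨0, hδ⟩
    · rw [hu]
    · refine SimpleGraph.Adj.reachable ?_
      rcases u with i | j
      · simp only [Sum.inl.injEq] at hu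
        simpa [extremalGraph, join] using fun h => hu h.symm
      · simp [extremalGraph, join]
  exact { preconnected := fun u w => (h u).symm.trans (h w), nonempty := ⟨Sum.inl ⟨0, hδ⟩⟩ }

/-- Summing the Perron equations over the three classes gives a linear system in the class sums.
Eliminating `B` and `C` leaves the polynomial times `A > 0`; adding the first two equations gives
the bound. -/
theorem rho_extremalGraph {n δ : ℕ} (hδ : 0 < δ) (hn : 2 * δ < n) :
    (n - δ : ℝ) < rho (extremalGraph n δ) + 1 ∧
      quotientCharpoly n δ (rho (extremalGraph n δ) + 1) = 0 := by
  classical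
  obtain ⟨y, hy, hyG⟩ := exists_pos_eigenvector (extremalGraph_connected (n := n) hδ)
  set x := rho (extremalGraph n δ)
  have : Nonempty (Fin δ) := ⟨⟨0, hδ⟩⟩
  have : Nonempty (Fin (n - 2 * δ)) := ⟨⟨0, by omega⟩⟩
  set A := ∑ i, y (Sum.inl i) with hA
  set B := ∑ i, y (Sum.inr (Sum.inl i)) with hB
  set C := ∑ i, y (Sum.inr (Sum.inr i)) with hC
  have hA0 : 0 < A := Finset.sum_pos (fun _ _ => hy _) Finset.univ_nonempty
  have hB0 : 0 < B := Finset.sum_pos (fun _ _ => hy _) Finset.univ_nonempty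
  have hC0 : 0 < C := Finset.sum_pos (fun _ _ => hy _) Finset.univ_nonempty
  have hclique : ∀ {m : ℕ} (f : Fin m → ℝ) (i : Fin m) (_ : ∀ j, Decidable (i = j)),
      (∑ j, if i = j then 0 else f j) = ∑ j, f j - f i := by
    intro m f i _
    rw [eq_sub_iff_add_eq, ← Finset.sum_erase_add _ f (Finset.mem_univ i)]
    congr 1
    rw [← Finset.sum_erase_add _ _ (Finset.mem_univ i), if_pos rfl, add_zero]
    exact Finset.sum_congr rfl fun j hj => if_neg (Finset.ne_of_mem_erase hj).symm
  have e1 : ∀ i, (x + 1) * y (Sum.inl i) = A + B + C := by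
    intro i
    have := hyG (Sum.inl i)
    simp [nbrSum, Fintype.sum_sum_type, extremalGraph, join] at this
    rw [hclique (fun j => y (Sum.inl j))] at this
    linarith
  have e2 : ∀ i, (x + 1) * y (Sum.inr (Sum.inl i)) = A + B := by
    intro i
    have := hyG (Sum.inr (Sum.inl i))
    simp [nbrSum, Fintype.sum_sum_type, extremalGraph, join] at this
    have h4 : A + (B - y (Sum.inr (Sum.inl i))) = x * y (Sum.inr (Sum.inl i)) := by
      rw [← this, hB, ← hclique (fun j => y (Sum.inr (Sum.inl j))) i fun _ => Classical.dec _]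
      congr!
    linarith
  have e3 : ∀ i, x * y (Sum.inr (Sum.inr i)) = A := by
    intro i
    have := hyG (Sum.inr (Sum.inr i))
    simp [nbrSum, Fintype.sum_sum_type, extremalGraph, join] at this
    linarith
  have f1 : (x + 1) * A = δ * (A + B + C) := by
    rw [hA, Finset.mul_sum, Finset.sum_congr rfl fun i _ => e1 i, ← hA]
    simp; ring
  have f2 : (x + 1) * B = (n - 2 * δ) * (A + B) := by
    rw [hB, Finset.mul_sum, Finset.sum_congr rfl fun i _ => e2 i, ← hB]
    simp [Nat.cast_sub hn.le]; ring
  have f3 : x * C = δ * A := by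
    rw [hC, Finset.mul_sum, Finset.sum_congr rfl fun i _ => e3 i]
    simp
  have hδ' : (0 : ℝ) < δ := Nat.cast_pos.2 hδ
  constructor
  · have : (n - δ : ℝ) * (A + B) < (x + 1) * (A + B) := by nlinarith [mul_pos hδ' hC0]
    exact lt_of_mul_lt_mul_right this (by positivity)
  · refine (mul_eq_zero.1 (?_ : A * _ = 0)).resolve_left hA0.ne'
    unfold quotientCharpoly
    linear_combination (x * (x + 1 - n + 2 * δ)) * f1 + δ * x * f2 + δ * (x + 1 - n + 2 * δ) * f3

/-- The difference of the values at `s` and `δ` is divisible by `s - δ`. The cofactor is bounded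
below by putting `n - δ` for `X`, and is then positive because `n` is large against `δ`. -/
theorem quotientCharpoly_pos {n δ s X : ℝ} (hδ : 0 ≤ δ) (hδs : δ < s) (hs : 2 * s + 1 ≤ n)
    (hn : 8 * δ + 4 ≤ n) (hX : n - δ < X) (h0 : quotientCharpoly n δ X = 0) :
    0 < quotientCharpoly n s X := by
  have key : quotientCharpoly n s X - quotientCharpoly n δ X = (s - δ) *
      ((X - 1) * (X - s - δ) + (s + δ) * (n - 1) - 2 * (s ^ 2 + s * δ + δ ^ 2)) := by
    unfold quotientCharpoly; ring
  have h1 : (n - δ - 1) * (n - 2 * δ - s) ≤ (X - 1) * (X - s - δ) :=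
    mul_le_mul (by linarith) (by linarith) (by linarith) (by linarith)
  have h2 : 0 < (n - δ - 1) * (n - 2 * δ - s) + (s + δ) * (n - 1)
      - 2 * (s ^ 2 + s * δ + δ ^ 2) := by
    nlinarith [mul_nonneg (sub_nonneg.2 hδs.le) (sub_nonneg.2 hs), mul_nonneg hδ (sub_nonneg.2 hn),
      mul_nonneg (sub_nonneg.2 hn) (sub_nonneg.2 hs), mul_nonneg (sub_nonneg.2 hn) (sub_nonneg.2 hn),
      mul_nonneg (sub_nonneg.2 hδs.le) hδ, mul_nonneg (sub_nonneg.2 hδs.le) (sub_nonneg.2 hn)]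
  have := mul_pos (sub_pos.2 hδs) (lt_of_lt_of_le h2 (by linarith : _ ≤
      (X - 1) * (X - s - δ) + (s + δ) * (n - 1) - 2 * (s ^ 2 + s * δ + δ ^ 2)))
  linarith

/-- The two sides differ by the polynomial over (X - 1)(X - (n - 2s)). The fractions s/(X - 1) and
s/(X - (n - 2s)) are the later test-vector weights. -/
theorem div_add_div_lt_of_quotientCharpoly_pos {n s X : ℝ} (hX1 : 1 < X) (hX : n - 2 * s < X)
    (h : 0 < quotientCharpoly n s X) :
    s + s * (s / (X - 1)) + (n - 2 * s) * (s / (X - (n - 2 * s))) < X := by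
  obtain ⟨N, hN⟩ : ∃ N, N = n - 2 * s := ⟨_, rfl⟩
  rw [← hN] at hX ⊢
  have h1 : 0 < X - 1 := by linarith
  have h2 : 0 < X - N := by linarith
  have e : X - (s + s * (s / (X - 1)) + N * (s / (X - N))) =
      quotientCharpoly n s X / ((X - 1) * (X - N)) := by
    have : n = N + 2 * s := by linarith
    unfold quotientCharpoly; rw [this]; field_simp; ring
  have := div_pos h (mul_pos h1 h2)
  linarith

/-- Here `t` is the shortfall of isolated vertices from `s`. It contributes an extra positive term
to the slack, so a vanishing polynomial is enough. -/
theorem div_add_div_lt_of_quotientCharpoly_nonneg {n s t X : ℝ} (hs : 0 < s) (ht : 0 < t)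
    (hN : 1 ≤ n - 2 * s) (hX : n - 2 * s < X) (h : 0 ≤ quotientCharpoly n s X) :
    s + (s - t) * (s / (X - 1)) + (n - 2 * s + t) * (s / (X - (n - 2 * s - t))) < X := by
  obtain ⟨N, hNdef⟩ : ∃ N, N = n - 2 * s := ⟨_, rfl⟩
  have h1 : 0 < X - 1 := by linarith
  have h2 : 0 < X - N := by linarith
  have h3 : 0 < X - (N - t) := by linarith
  have e : X - (s + (s - t) * (s / (X - 1)) + (N + t) * (s / (X - (N - t)))) =
      quotientCharpoly n s X / ((X - 1) * (X - N)) +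
        s * t * (N * (X - 1) - (N - t - 1) * (X - N)) / ((X - 1) * (X - N) * (X - (N - t))) := by
    have : n = N + 2 * s := by linarith
    unfold quotientCharpoly; rw [this]; field_simp; ring
  have h4 : 0 < N * (X - 1) - (N - t - 1) * (X - N) := by nlinarith
  have h5 : 0 < s * t * (N * (X - 1) - (N - t - 1) * (X - N)) /
      ((X - 1) * (X - N) * (X - (N - t))) := by positivity
  have h6 := div_nonneg h (mul_pos h1 h2).le
  rw [← hNdef]
  linarith

/-! ### Counting vertices by components -/

theorem isIsolated_iff_supp_ncard_le_one {W : Type*} [Finite W] {H : SimpleGraph W} {u : W} :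
    H.IsIsolated u ↔ (H.connectedComponentMk u).supp.ncard ≤ 1 := by
  constructor
  · intro hu
    rw [Set.ncard_le_one]
    have h : ∀ w, H.Reachable w u → w = u := by
      rintro w ⟨p⟩
      cases p.reverse with
      | nil => rfl
      | cons h _ => exact (hu _ h).elim
    intro a ha b hb
    rw [SimpleGraph.ConnectedComponent.mem_supp_iff, SimpleGraph.ConnectedComponent.eq] at ha hb
    rw [h a ha, h b hb]
  · intro hu w hw
    rw [Set.ncard_le_one] at hu
    refine hw.ne (hu u ?_ w ?_)
    · simp
    · rw [SimpleGraph.ConnectedComponent.mem_supp_iff, SimpleGraph.ConnectedComponent.eq]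
      exact hw.symm.reachable

theorem isolatedCount_add_sum_ncard_le {W : Type*} [Fintype W] (H : SimpleGraph W)
    (T : Finset H.ConnectedComponent) (hT : ∀ c ∈ T, 1 < c.supp.ncard) :
    isolatedCount H + ∑ c ∈ T, c.supp.ncard ≤ Fintype.card W := by
  classical
  have h1 : ∑ c ∈ T, c.supp.ncard = #(T.biUnion fun c => c.supp.toFinset) := by
    rw [Finset.card_biUnion]
    · exact Finset.sum_congr rfl fun c _ => Set.ncard_eq_toFinset_card' _
    · intro c _ d _ hcd
      rw [Function.onFun, Finset.disjoint_left]
      intro w hw hw'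
      rw [Set.mem_toFinset] at hw hw'
      exact hcd (SimpleGraph.ConnectedComponent.eq_of_common_vertex hw hw')
  rw [h1, isolatedCount, Set.ncard_eq_toFinset_card', ← Finset.card_union_of_disjoint]
  · exact Finset.card_le_univ _
  · rw [Finset.disjoint_left]
    intro w hw hw'
    simp only [Set.mem_toFinset, Set.mem_ofPred_eq, Finset.mem_biUnion] at hw hw'
    obtain ⟨c, hc, hwc⟩ := hw'
    rw [SimpleGraph.ConnectedComponent.mem_supp_iff] at hwc
    rw [isIsolated_iff_supp_ncard_le_one, hwc] at hw
    exact (hT c hc).not_ge hw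

theorem neighborSet_ncard_lt_supp_ncard {W : Type*} [Finite W] (H : SimpleGraph W) (u : W) :
    (H.neighborSet u).ncard < (H.connectedComponentMk u).supp.ncard := by
  refine Set.ncard_lt_ncard ⟨fun w hw => ?_, fun h => ?_⟩
  · rw [SimpleGraph.ConnectedComponent.mem_supp_iff, SimpleGraph.ConnectedComponent.eq]
    exact (SimpleGraph.Adj.reachable hw).symm
  · exact H.loopless.irrefl u (h (by simp))

/-- A vertex that is not isolated misses the isolated vertices and all but one of the nontrivial odd
components. -/
theorem ncard_neighborSet_add_le {W : Type*} [Fintype W] (H : SimpleGraph W) {u : W}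
    (hu : ¬ H.IsIsolated u) {m : ℕ}
    (hm : ∀ c : H.ConnectedComponent, Odd c.supp.ncard → 1 < c.supp.ncard → m ≤ c.supp.ncard) :
    (H.neighborSet u).ncard + 1 + isolatedCount H + m * (nontrivialOddCount H - 1) ≤
      Fintype.card W := by
  classical
  let T : Finset H.ConnectedComponent := {c | Odd c.supp.ncard ∧ 1 < c.supp.ncard}
  have hTc : nontrivialOddCount H = #T := by
    rw [nontrivialOddCount, Set.ncard_eq_toFinset_card']
    congr 1
    ext; simp [T]
  let c := H.connectedComponentMk u
  -- The component of `u` may be even, so it is inserted separately; this costs at most one odd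
  -- component.
  have h1 := isolatedCount_add_sum_ncard_le H (insert c (T.erase c)) (by
    intro d hd
    rw [Finset.mem_insert] at hd
    rcases hd with rfl | hd
    · exact not_le.1 fun h => hu (isIsolated_iff_supp_ncard_le_one.2 h)
    · exact (Finset.mem_filter.1 (Finset.mem_of_mem_erase hd)).2.2)
  rw [Finset.sum_insert (Finset.notMem_erase _ _)] at h1
  have h2 : #(T.erase c) * m ≤ ∑ d ∈ T.erase c, d.supp.ncard := by
    refine Finset.card_nsmul_le_sum _ _ _ fun d hd => ?_
    obtain ⟨h3, h4⟩ := (Finset.mem_filter.1 (Finset.mem_of_mem_erase hd)).2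
    exact hm d h3 h4
  have h5 : #T - 1 ≤ #(T.erase c) := Finset.pred_card_le_card_erase
  have h6 := neighborSet_ncard_lt_supp_ncard H u
  have h7 : m * (#T - 1) ≤ #(T.erase c) * m := by
    rw [mul_comm]; exact Nat.mul_le_mul_right _ h5
  rw [hTc]
  change _ < c.supp.ncard at h6
  omega

theorem isolatedCount_add_three_mul_le {W : Type*} [Fintype W] (H : SimpleGraph W) :
    isolatedCount H + 3 * nontrivialOddCount H ≤ Fintype.card W := by
  classical
  let T : Finset H.ConnectedComponent := {c | Odd c.supp.ncard ∧ 1 < c.supp.ncard}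
  have hTc : nontrivialOddCount H = #T := by
    rw [nontrivialOddCount, Set.ncard_eq_toFinset_card']
    congr 1
    ext; simp [T]
  have h1 := isolatedCount_add_sum_ncard_le H T fun c hc => (Finset.mem_filter.1 hc).2.2
  have h2 : #T * 3 ≤ ∑ d ∈ T, d.supp.ncard := by
    refine Finset.card_nsmul_le_sum T (fun d => d.supp.ncard) 3 fun d hd => ?_
    obtain ⟨⟨r, hr⟩, h4⟩ := (Finset.mem_filter.1 hd).2
    omega
  omega

theorem nontrivialOddCount_pos_of_connected {W : Type*} [Fintype W] {H : SimpleGraph W}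
    (hH : H.Connected) (hodd : Odd (Fintype.card W)) (h1 : 1 < Fintype.card W) :
    0 < nontrivialOddCount H := by
  obtain ⟨w⟩ := hH.nonempty
  have hs : (H.connectedComponentMk w).supp = Set.univ := by
    ext u
    rw [SimpleGraph.ConnectedComponent.mem_supp_iff, SimpleGraph.ConnectedComponent.eq]
    simpa using hH.preconnected u w
  rw [nontrivialOddCount, Set.ncard_pos]
  refine ⟨H.connectedComponentMk w, ?_⟩
  rw [Set.mem_ofPred_eq, hs, Set.ncard_univ, Nat.card_eq_fintype_card]
  exact ⟨hodd, h1⟩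

/-! ### Transfer to vertex deletion -/

open Classical in
theorem ncard_neighborSet_deleteVerts {V : Type*} [Fintype V] (G : SimpleGraph V) (S : Finset V)
    {u : V} (hu : u ∉ S) :
    ((deleteVerts G S).neighborSet ⟨u, by simpa using hu⟩).ncard =
      #{w | G.Adj u w ∧ w ∉ S} := by
  rw [← Set.ncard_image_of_injective _ Subtype.val_injective, ← Set.ncard_coe_finset]
  congr 1
  ext w
  simp [and_comm]

open Classical in
/-- The vertices outside `S` whose neighbours all lie in `S`. -/
noncomputable def isolatedAfter {V : Type*} [Fintype V] (G : SimpleGraph V) (S : Finset V) :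
    Finset V :=
  {u | u ∉ S ∧ ∀ w, G.Adj u w → w ∈ S}

theorem mem_isolatedAfter {V : Type*} [Fintype V] {G : SimpleGraph V} {S : Finset V} {u : V} :
    u ∈ isolatedAfter G S ↔ u ∉ S ∧ ∀ w, G.Adj u w → w ∈ S := by
  simp [isolatedAfter]

theorem isIsolated_deleteVerts_iff {V : Type*} [Fintype V] {G : SimpleGraph V} {S : Finset V}
    {u : V} (hu : u ∉ S) :
    (deleteVerts G S).IsIsolated ⟨u, by simpa using hu⟩ ↔ u ∈ isolatedAfter G S := by
  simp only [mem_isolatedAfter, hu, not_false_iff, true_and]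
  refine ⟨fun h w hw => ?_, fun h w hw => w.2 (h _ hw)⟩
  by_contra hwS
  exact h ⟨w, by simpa using hwS⟩ hw

theorem isolatedCount_deleteVerts {V : Type*} [Fintype V] (G : SimpleGraph V) (S : Finset V) :
    isolatedCount (deleteVerts G S) = #(isolatedAfter G S) := by
  classical
  rw [isolatedCount, ← Set.ncard_image_of_injective _ Subtype.val_injective,
    ← Set.ncard_coe_finset]
  congr 1
  ext w
  constructor
  · rintro ⟨⟨v, hv⟩, h, rfl⟩
    exact (isIsolated_deleteVerts_iff (by simpa using hv)).1 h
  · intro hw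
    have hwS : w ∉ S := (mem_isolatedAfter.1 hw).1
    exact ⟨⟨w, by simpa using hwS⟩, (isIsolated_deleteVerts_iff hwS).2 hw, rfl⟩

theorem card_deleteVerts {V : Type*} [Fintype V] (S : Finset V) [Fintype ((S : Set V)ᶜ : Set V)] :
    Fintype.card ((S : Set V)ᶜ : Set V) + #S = Fintype.card V := by
  classical
  have := Finset.card_add_card_compl S
  rw [← this, add_comm, ← Set.toFinset_card]
  congr 2
  ext; simp

theorem exists_equiv_extremalGraph {V : Type*} [Fintype V] {G : SimpleGraph V} {n δ : ℕ}
    (hcard : Fintype.card V = n) {S I : Finset V} (hSI : Disjoint S I) (hS : #S = δ) (hI : #I = δ)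
    (hadj : ∀ u ∈ I, ∀ w, G.Adj u w → w ∈ S) :
    ∃ e : V ≃ Fin δ ⊕ (Fin (n - 2 * δ) ⊕ Fin δ),
      ∀ u w, G.Adj u w → (extremalGraph n δ).Adj (e u) (e w) := by
  classical
  have hU : #(S ∪ I) = 2 * δ := by rw [Finset.card_union_of_disjoint hSI]; omega
  have hn : 2 * δ ≤ n := by rw [← hU, ← hcard]; exact Finset.card_le_univ _
  have hR : #(S ∪ I)ᶜ = n - 2 * δ := by rw [Finset.card_compl, hU, hcard]
  obtain ⟨f, fS, fR, fI, hinj⟩ : ∃ f : Fin δ ⊕ (Fin (n - 2 * δ) ⊕ Fin δ) → V,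
      (∀ i, f (Sum.inl i) ∈ S) ∧ (∀ i, f (Sum.inr (Sum.inl i)) ∉ S ∧ f (Sum.inr (Sum.inl i)) ∉ I) ∧
      (∀ i, f (Sum.inr (Sum.inr i)) ∈ I) ∧ Function.Injective f := by
    have hS' : ∀ i, ((S.equivFinOfCardEq hS).symm i : V) ∈ S := fun i => Subtype.property _
    have hI' : ∀ i, ((I.equivFinOfCardEq hI).symm i : V) ∈ I := fun i => Subtype.property _
    have hR' : ∀ i, (((S ∪ I)ᶜ.equivFinOfCardEq hR).symm i : V) ∉ S ∧
        (((S ∪ I)ᶜ.equivFinOfCardEq hR).symm i : V) ∉ I := fun i => by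
      have := ((S ∪ I)ᶜ.equivFinOfCardEq hR).symm i |>.2
      simpa only [Finset.mem_compl, Finset.mem_union, not_or] using this
    refine ⟨Sum.elim (fun i => ((S.equivFinOfCardEq hS).symm i : V))
      (Sum.elim (fun i => (((S ∪ I)ᶜ.equivFinOfCardEq hR).symm i : V))
        (fun i => ((I.equivFinOfCardEq hI).symm i : V))), hS', hR', hI', ?_⟩
    refine Function.Injective.sumElim
      (Subtype.val_injective.comp (Equiv.injective _))
      (Function.Injective.sumElim (Subtype.val_injective.comp (Equiv.injective _))
        (Subtype.val_injective.comp (Equiv.injective _)) ?_) ?_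
    · intro i j h
      exact (hR' i).2 (by rw [h]; exact hI' j)
    · rintro i (j | j) h
      · exact (hR' j).1 (by rw [Sum.elim_inl] at h; rw [← h]; exact hS' i)
      · exact Finset.disjoint_right.1 hSI (hI' j)
          (by rw [Sum.elim_inr] at h; rw [← h]; exact hS' i)
  have fI' : ∀ i, f (Sum.inr (Sum.inr i)) ∉ S := fun i => Finset.disjoint_right.1 hSI (fI i)
  have hbij : Function.Bijective f := by
    rw [Fintype.bijective_iff_injective_and_card]
    refine ⟨hinj, ?_⟩
    simp only [Fintype.card_sum, Fintype.card_fin]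
    omega
  refine ⟨(Equiv.ofBijective f hbij).symm, fun u w huw => ?_⟩
  obtain ⟨a, rfl⟩ := hbij.2 u
  obtain ⟨b, rfl⟩ := hbij.2 w
  rw [Equiv.ofBijective_symm_apply_apply, Equiv.ofBijective_symm_apply_apply]
  have hab : a ≠ b := fun h => huw.ne (congrArg f h)
  rcases a with i | i | i <;> rcases b with j | j | j
  · simpa [extremalGraph, join] using hab
  · simp [extremalGraph, join]
  · simp [extremalGraph, join]
  · simp [extremalGraph, join]
  · simpa [extremalGraph, join] using hab
  · exact ((fR i).1 (hadj _ (fI j) _ huw.symm)).elim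
  · simp [extremalGraph, join]
  · exact ((fR j).1 (hadj _ (fI i) _ huw)).elim
  · exact (fI' j (hadj _ (fI i) _ huw)).elim

open Classical in
theorem card_filter_adj_notMem_add_le {V : Type*} [Fintype V] (G : SimpleGraph V) {S : Finset V}
    {u : V} (hu : u ∉ S) (hI : u ∉ isolatedAfter G S) {m : ℕ}
    (hm : ∀ c : (deleteVerts G S).ConnectedComponent, Odd c.supp.ncard → 1 < c.supp.ncard →
      m ≤ c.supp.ncard) :
    #{w | G.Adj u w ∧ w ∉ S} + 1 + #(isolatedAfter G S) +
      m * (nontrivialOddCount (deleteVerts G S) - 1) + #S ≤ Fintype.card V := by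
  have h := ncard_neighborSet_add_le (deleteVerts G S)
    (fun h => hI ((isIsolated_deleteVerts_iff hu).1 h)) hm
  rw [ncard_neighborSet_deleteVerts G S hu, isolatedCount_deleteVerts] at h
  have := card_deleteVerts S
  omega

theorem ncard_neighborSet_lt_card_add_supp_ncard {V : Type*} [Fintype V] (G : SimpleGraph V)
    {S : Finset V} {u : V} (hu : u ∉ S) :
    (G.neighborSet u).ncard < #S + ((deleteVerts G S).connectedComponentMk
      ⟨u, by simpa using hu⟩).supp.ncard := by
  classical
  have h1 := neighborSet_ncard_lt_supp_ncard (deleteVerts G S) ⟨u, by simpa using hu⟩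
  rw [ncard_neighborSet_deleteVerts G S hu] at h1
  have h2 : G.neighborSet u ⊆ (S ∪ ({w | G.Adj u w ∧ w ∉ S} : Finset V) : Finset V) := by
    intro w hw
    by_cases hwS : w ∈ S <;> simp_all
  have h3 := Set.ncard_le_ncard h2
  rw [Set.ncard_coe_finset] at h3
  have h4 := h3.trans (Finset.card_union_le _ _)
  convert h4.trans_lt (Nat.add_lt_add_left h1 _)

theorem ncard_neighborSet_le_card {V : Type*} [Fintype V] {G : SimpleGraph V} {S : Finset V}
    {u : V} (hu : u ∈ isolatedAfter G S) : (G.neighborSet u).ncard ≤ #S := by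
  rw [← Set.ncard_coe_finset]
  exact Set.ncard_le_ncard fun w hw => (mem_isolatedAfter.1 hu).2 w hw

/-! ### Test vectors for each range of s and i -/

/-- The case in which `S` is smaller than the minimum degree. -/
theorem rho_lt_of_card_lt_minDegree {V : Type*} [Fintype V] {G : SimpleGraph V}
    (hG : G.Connected) {n δ : ℕ} (hcard : Fintype.card V = n)
    (hn : 8 * δ + 4 ≤ n) (hdeg : ∀ u, δ ≤ (G.neighborSet u).ncard) {S : Finset V} (hS : S.Nonempty) (hSδ : #S < δ)
    (ho : 3 * #S < nontrivialOddCount (deleteVerts G S)) {x : ℝ} (hx : (n : ℝ) - δ < x + 1) :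
    rho G < x := by
  classical
  have hs : 1 ≤ #S := hS.card_pos
  have hm : ∀ c : (deleteVerts G S).ConnectedComponent, Odd c.supp.ncard → 1 < c.supp.ncard →
      max 3 (δ + 1 - #S) ≤ c.supp.ncard := by
    intro c ⟨r, hr⟩ h1
    obtain ⟨⟨u, hu⟩, rfl⟩ := c.exists_rep
    have h2 := ncard_neighborSet_lt_card_add_supp_ncard G (S := S) (u := u) (by simpa using hu)
    have h3 := hdeg u
    rw [max_le_iff]
    change _ < #S + Set.ncard (SimpleGraph.ConnectedComponent.supp (Quot.mk _ _)) at h2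
    omega
  have hI : ∀ u, u ∉ isolatedAfter G S := by
    intro u hu
    exact ((hdeg u).trans (ncard_neighborSet_le_card hu)).not_gt hSδ
  have hnR : (8 * δ + 4 : ℝ) ≤ n := by exact_mod_cast hn
  have hsδR : (#S + 1 : ℝ) ≤ δ := by exact_mod_cast hSδ
  have hsR : (1 : ℝ) ≤ #S := by exact_mod_cast hs
  have hx0 : 0 < x := by linarith
  -- With b = 1/6 the s from `S` cancels the 6s in `d`, leaving exactly n - δ - 1 ≤ x.
  refine rho_lt_of_three_classes hG (S := S) (I := ∅) (b := 1 / 6) (c := #S / x)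
    (d := n - 6 * #S - δ - 1) hS (by simp) (by simp) (by norm_num) (by positivity) ?_ ?_ ?_ ?_
  · intro u hu _
    have h1 := card_filter_adj_notMem_add_le G hu (hI u) hm
    -- At least 3s other components of size m: two thirds of 3sm use m ≥ 3, the last third m ≥ δ - s
    -- + 1.
    have h2 : 5 * #S + δ ≤
        max 3 (δ + 1 - #S) * (nontrivialOddCount (deleteVerts G S) - 1) := by
      obtain ⟨e, rfl⟩ : ∃ e, δ = #S + e := ⟨δ - #S, by omega⟩
      have h3 : max 3 (#S + e + 1 - #S) * (3 * #S) ≤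
          max 3 (#S + e + 1 - #S) * (nontrivialOddCount (deleteVerts G S) - 1) :=
        Nat.mul_le_mul_left _ (by omega)
      have h4 : e + 1 ≤ max 3 (#S + e + 1 - #S) := by omega
      have h5 : 3 ≤ max 3 (#S + e + 1 - #S) := le_max_left _ _
      have h6 := Nat.mul_le_mul_right #S h4
      have h7 := Nat.mul_le_mul_right #S h5
      have h8 : e * 1 ≤ e * #S := Nat.mul_le_mul_left _ hs
      have h9 : (e + 1) * #S = e * #S + #S := by ring
      have h10 : ∀ μ : ℕ, μ * (3 * #S) = 3 * (μ * #S) := fun μ => by ring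
      rw [h10] at h3
      omega
    have h3 : #{w | G.Adj u w ∧ w ∉ S} + 1 + (6 * #S + δ) ≤ n := by omega
    have h4 : ((#{w | G.Adj u w ∧ w ∉ S} + 1 + (6 * #S + δ) : ℕ) : ℝ) ≤ n := by exact_mod_cast h3
    push_cast at h4 ⊢
    linarith
  · rw [hcard]
    simp only [Finset.card_empty, Nat.cast_zero]
    linarith
  · exact (mul_div_cancel₀ _ hx0.ne').ge
  · linarith

/-- The case in which at least `#S` vertices become isolated. -/
theorem rho_lt_of_card_le_isolated {V : Type*} [Fintype V] {G : SimpleGraph V}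
    (hG : G.Connected) {n : ℕ} (hcard : Fintype.card V = n) {S I : Finset V} (hS : S.Nonempty)
    (hSI : Disjoint S I) (hI : ∀ u ∈ I, ∀ w, G.Adj u w → w ∈ S) (hIS : #I = #S) {x : ℝ}
    (hx0 : 0 < x) (hx : (n : ℝ) - 2 * #S < x + 1) (hq : 0 < quotientCharpoly n #S (x + 1)) :
    rho G < x := by
  classical
  have hs : (0 : ℝ) < #S := by exact_mod_cast hS.card_pos
  have h := div_add_div_lt_of_quotientCharpoly_pos (by linarith) hx hq
  rw [add_sub_cancel_right] at h
  have hb : 0 < x + 1 - ((n : ℝ) - 2 * #S) := by linarith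
  -- These weights make the conditions on `I` and on the rest equalities; the condition on `S` is
  -- then the polynomial inequality.
  refine rho_lt_of_three_classes hG (S := S) (I := I) (c := #S / x)
    (b := #S / (x + 1 - ((n : ℝ) - 2 * #S))) (d := n - 2 * #S - 1) hS hSI hI (by positivity)
    (by positivity) ?_ ?_ (mul_div_cancel₀ _ hx0.ne').ge ?_
  · intro u huS huI
    have h1 : ({w | G.Adj u w ∧ w ∉ S} : Finset V) ⊆ (insert u (S ∪ I))ᶜ := by
      intro w hw
      obtain ⟨h1, h2⟩ := (Finset.mem_filter.1 hw).2
      have h3 : w ∉ I := fun h => huS (hI w h u h1.symm)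
      simp [h2, h3, h1.ne']
    have h2 := Finset.card_le_card h1
    have h3 : #(insert u (S ∪ I)) = 2 * #S + 1 := by
      rw [Finset.card_insert_of_notMem (by simp [huS, huI]), Finset.card_union_of_disjoint hSI]
      omega
    have h4 := Finset.card_le_univ (insert u (S ∪ I))
    rw [Finset.card_compl, h3] at h2
    rw [h3] at h4
    have h5 : #{w | G.Adj u w ∧ w ∉ S} + 2 * #S + 1 ≤ n := by omega
    have h6 : ((#{w | G.Adj u w ∧ w ∉ S} + 2 * #S + 1 : ℕ) : ℝ) ≤ n := by exact_mod_cast h5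
    push_cast at h6 ⊢
    linarith
  · rw [hcard, hIS]
    linarith
  · have : (#S : ℝ) / (x + 1 - (n - 2 * #S)) * (x + 1 - (n - 2 * #S)) = #S :=
      div_mul_cancel₀ _ hb.ne'
    linarith

/-- The case in which fewer than `#S` vertices become isolated. -/
theorem rho_lt_of_isolated_lt_card {V : Type*} [Fintype V] {G : SimpleGraph V}
    (hG : G.Connected) {n : ℕ} (hcard : Fintype.card V = n) {S : Finset V} (hS : S.Nonempty)
    (hlt : #(isolatedAfter G S) < #S) (hn : 2 * #S + 1 ≤ n)
    (ho : 3 * #S < nontrivialOddCount (deleteVerts G S) + 3 * #(isolatedAfter G S)) {x : ℝ}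
    (hx0 : 0 < x) (hx : (n : ℝ) - 2 * #S < x + 1) (hq : 0 ≤ quotientCharpoly n #S (x + 1)) :
    rho G < x := by
  classical
  have hs : (0 : ℝ) < #S := by exact_mod_cast hS.card_pos
  have hnR : (2 * #S + 1 : ℝ) ≤ n := by exact_mod_cast hn
  obtain ⟨t, ht⟩ : ∃ t, #S = #(isolatedAfter G S) + t := ⟨#S - #(isolatedAfter G S), by omega⟩
  have htR : (#S : ℝ) = #(isolatedAfter G S) + t := by exact_mod_cast ht
  have ht0 : (0 : ℝ) < t := by
    have : 0 < t := by omega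
    exact_mod_cast this
  have h := div_add_div_lt_of_quotientCharpoly_nonneg hs ht0 (by linarith) hx hq
  rw [add_sub_cancel_right] at h
  have hb : 0 < x + 1 - ((n : ℝ) - 2 * #S - t) := by linarith
  refine rho_lt_of_three_classes hG (S := S) (I := isolatedAfter G S) (c := #S / x)
    (b := #S / (x + 1 - ((n : ℝ) - 2 * #S - t))) (d := n - 2 * #S - t - 1) hS ?_
    (fun u hu => (mem_isolatedAfter.1 hu).2) (by positivity)
    (by positivity) ?_ ?_ (mul_div_cancel₀ _ hx0.ne').ge ?_
  · rw [Finset.disjoint_right]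
    exact fun u hu => (mem_isolatedAfter.1 hu).1
  · intro u huS huI
    -- At least 3t other components with three or more vertices are missed, which is more than the
    -- bound `d` needs.
    have h1 := card_filter_adj_notMem_add_le G huS huI (m := 3) (by
      intro c ⟨r, hr⟩ h1
      omega)
    have h5 : #{w | G.Adj u w ∧ w ∉ S} + 2 * #S + t + 1 ≤ n := by omega
    have h6 : ((#{w | G.Adj u w ∧ w ∉ S} + 2 * #S + t + 1 : ℕ) : ℝ) ≤ n := by exact_mod_cast h5
    push_cast at h6 ⊢
    linarith
  · rw [hcard]
    have e1 : (#(isolatedAfter G S) : ℝ) = #S - t := by linarith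
    have e2 : (n : ℝ) - #S - (#S - t) = n - 2 * #S + t := by ring
    rw [e1, e2]
    linarith
  · have : (#S : ℝ) / (x + 1 - (n - 2 * #S - t)) * (x + 1 - (n - 2 * #S - t)) = #S :=
      div_mul_cancel₀ _ hb.ne'
    linarith

theorem nontrivialOddCount_add_le {V : Type*} [Fintype V] {G : SimpleGraph V}
    {n δ k : ℕ} (hδ : 0 < δ) (hk : 3 ≤ k) (hcard : Fintype.card V = n) (hn : 8 * δ + 4 ≤ n)
    (hconn : G.Connected) (hdeg : ∀ u, δ ≤ (G.neighborSet u).ncard) (hrho : rho (extremalGraph n δ) ≤ rho G)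
    (hne : ¬ Nonempty (G ≃g extremalGraph n δ)) {S : Finset V} (hS : S.Nonempty) :
    nontrivialOddCount (deleteVerts G S) + k * isolatedCount (deleteVerts G S) ≤ k * #S := by
  classical
  by_contra! hlt
  obtain ⟨hx, hq⟩ := rho_extremalGraph (n := n) hδ (by omega)
  refine hrho.not_gt ?_
  set x := rho (extremalGraph n δ)
  have hs : 1 ≤ #S := hS.card_pos
  have htot := isolatedCount_add_three_mul_le (deleteVerts G S)
  have hc := card_deleteVerts S
  rw [isolatedCount_deleteVerts] at hlt htot
  -- Since k ≥ 3, the violation for `k` implies the one for 3.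
  have ho : #(isolatedAfter G S) < #S →
      3 * #S < nontrivialOddCount (deleteVerts G S) + 3 * #(isolatedAfter G S) := by
    intro h
    obtain ⟨t, ht⟩ := Nat.exists_eq_add_of_lt h
    rw [ht] at hlt ⊢
    nlinarith
  have hIδ : (isolatedAfter G S).Nonempty → δ ≤ #S := by
    rintro ⟨u, hu⟩
    exact (hdeg u).trans (ncard_neighborSet_le_card hu)
  rcases lt_or_ge #S δ with hSδ | hSδ
  · have hI : isolatedAfter G S = ∅ := by
      by_contra h
      exact hSδ.not_ge (hIδ (Finset.nonempty_iff_ne_empty.2 h))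
    rw [hI, Finset.card_empty] at ho
    exact rho_lt_of_card_lt_minDegree hconn hcard hn hdeg hS hSδ (by omega) hx
  have h2s : 2 * #S + 1 ≤ n := by
    rcases lt_trichotomy #(isolatedAfter G S) #S with h | h | h
    · have := ho h; omega
    · rw [h] at hlt; omega
    · omega
  have hnR : (8 * δ + 4 : ℝ) ≤ n := by exact_mod_cast hn
  have hsR : (δ : ℝ) ≤ #S := by exact_mod_cast hSδ
  have h2sR : (2 * #S + 1 : ℝ) ≤ n := by exact_mod_cast h2s
  have hδR : (1 : ℝ) ≤ δ := by exact_mod_cast hδ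
  have hx0 : 0 < x := by linarith
  have hx1 : (n : ℝ) - 2 * #S < x + 1 := by linarith
  have hpos : δ < #S → 0 < quotientCharpoly n #S (x + 1) := fun h =>
    quotientCharpoly_pos (by linarith) (by exact_mod_cast h) h2sR hnR hx hq
  rcases lt_or_ge #(isolatedAfter G S) #S with h | h
  · refine rho_lt_of_isolated_lt_card hconn hcard hS h h2s (ho h) hx0 hx1 ?_
    -- At s = δ the polynomial is only zero, which this case tolerates.
    rcases hSδ.eq_or_lt with h' | h'
    · rw [← h', hq]
    · exact (hpos h').le
  · obtain ⟨I, hIsub, hIS⟩ := Finset.exists_subset_card_eq h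
    have hadj : ∀ u ∈ I, ∀ w, G.Adj u w → w ∈ S := fun u hu =>
      (mem_isolatedAfter.1 (hIsub hu)).2
    have hSI : Disjoint S I := by
      rw [Finset.disjoint_right]
      exact fun u hu => (mem_isolatedAfter.1 (hIsub hu)).1
    rcases hSδ.eq_or_lt with h' | h'
    · obtain ⟨e, he⟩ := exists_equiv_extremalGraph hcard hSI h'.symm (hIS.trans h'.symm) hadj
      exact (hne (nonempty_iso_of_rho_le hconn (extremalGraph_connected hδ) e he hrho)).elim
    · exact rho_lt_of_card_le_isolated hconn hcard hS hSI hadj hIS hx0 hx1 (hpos h')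

end KMatching

theorem mainTheorem9 {V : Type*} [Fintype V] (G : SimpleGraph V) [DecidableRel G.Adj]
    (n δ k : ℕ) (hδ : 0 < δ) (hk : 3 ≤ k) (hkodd : Odd k)
    (hcard : Fintype.card V = n) (hnodd : Odd n) (hn : 8 * δ + 4 ≤ n)
    (hconn : G.Connected) (hdeg : δ ≤ G.minDegree)
    (hrho : KMatching.rho (KMatching.extremalGraph n δ) ≤ KMatching.rho G)
    (hne : ¬ Nonempty (G ≃g KMatching.extremalGraph n δ)) :
    KMatching.IsGFC k G := by
  classical
  have hempty : 0 < KMatching.bergeTutteValue k G ∅ := by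
    have e : KMatching.deleteVerts G ∅ ≃g G :=
      ⟨(Equiv.setCongr Set.compl_empty).trans (Equiv.Set.univ V), Iff.rfl⟩
    have hc : Fintype.card ((∅ : Set V)ᶜ : Set V) = n :=
      (Fintype.card_congr e.toEquiv).trans hcard
    have h1 := KMatching.nontrivialOddCount_pos_of_connected (H := KMatching.deleteVerts G ∅)
      (e.connected_iff.2 hconn) (hc ▸ hnodd) (by omega)
    rw [KMatching.bergeTutteValue, if_neg (Nat.not_even_iff_odd.2 hkodd), Set.ncard_empty]
    have : (0 : ℤ) ≤ k * KMatching.isolatedCount (KMatching.deleteVerts G ∅) := by positivity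
    simp only [Nat.cast_zero, mul_zero, sub_zero]
    omega
  have hdeg' : ∀ u, δ ≤ (G.neighborSet u).ncard := by
    intro u
    rw [Set.ncard_eq_toFinset_card', Set.toFinset_card, SimpleGraph.card_neighborSet_eq_degree]
    exact hdeg.trans (G.minDegree_le_degree u)
  have hnonempty : ∀ S : Set V, S ≠ ∅ → KMatching.bergeTutteValue k G S ≤ 0 := by
    intro S hS
    have h1 := KMatching.nontrivialOddCount_add_le hδ hk hcard hn hconn hdeg' hrho hne (S := S.toFinset)
      (by simpa using Set.nonempty_iff_ne_empty.2 hS)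
    rw [Set.coe_toFinset, ← Set.ncard_eq_toFinset_card'] at h1
    rw [KMatching.bergeTutteValue, if_neg (Nat.not_even_iff_odd.2 hkodd)]
    have h2 : ((KMatching.nontrivialOddCount (KMatching.deleteVerts G S) + k * KMatching.isolatedCount (KMatching.deleteVerts G S) : ℕ) : ℤ)
      ≤ (k * S.ncard : ℕ) := by exact_mod_cast h1
    push_cast at h2
    linarith
  refine ⟨hcard ▸ hnodd, fun S => ⟨fun hS => ?_, ?_⟩⟩
  · by_contra h
    have h1 := hS ∅
    have h2 := hnonempty S h
    linarith
  · rintro rfl T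
    by_cases hT : T = ∅
    · rw [hT]
    · exact (hnonempty T hT).trans hempty.le
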